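/- Let $d\ge 1$ and let $G$ be a measure on $(0,\infty)$ whose tail $\bar G(u)=G((u,\infty))$ is finite for every $u>0$. Let $h:\mathbb R^d\to[0,\infty]$ be measurable, let $\Phi$ be a Poisson point process on $\mathbb R^d\times(0,\infty)$ with intensity $dx\,G(dm)$ on a probability space $(\Omega,\mathcal F,\mathbb P)$, and let $$M(y)=\sup\{m\,h(y-x):(x,m)\in\Phi\}\in[0,\infty],\qquad y\in\mathbb R^d,$$ be the associated extremal shot noise (with $\sup\emptyset=0$). Put $$\alpha(h,G)=\inf\Big\{u\in(0,\infty):\int_{\mathbb R^d}\bar G(u/h(x))\,dx<\infty\Big\},\qquad \inf\emptyset=+\infty,$$ where $\bar G(u/h(x))$ is read as $0$ if $h(x)=0$ and as $G((0,\infty))$ if $h(x)=\infty$; put $\alpha^+(h,G)=\alpha(h^+,G)$ with $h^+(x)=\sup_{|z|\le1}h(x+z)$, and $\alpha^-(h,G)=\lim_{\varepsilon\downarrow0}\alpha(h^-_\varepsilon,G)$ with $h^-_\varepsilon(x)=\inf_{|z|\le\varepsilon}h(x+z)$. For a space $X$ of functions on $\mathbb R^d$ with a $\sigma$-field and the shifts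 $\tau_vf=f(\cdot+v)$, a random element $M$ of $X$ is called stationary if $\tau_vM$ has the same law as $M$ for every $v\in\mathbb R^d$. A stationary $M$ is called $\alpha$-mixing in $X$ if $$\lim_{|v|\to\infty}\mathbb P(M\in A,\ \tau_vM\in B)=\mathbb P(M\in A)\,\mathbb P(M\in B)$$ for all measurable $A,B\subseteq X$, and ergodic if $\mathbb P(M\in A)\in\{0,1\}$ for every measurable $A\subseteq X$ such that, for each $v\in\mathbb R^d$, almost surely $\tau_vM\in A\Leftrightarrow M\in A$. 1. $M$ is stationary and $\alpha$-mixing, hence ergodic, in $[0,\infty]^{\mathbb R^d}$ with the product $\sigma$-field. 2. If in addition $h$ is continuous and $\alpha^-(h,G)=\alpha^+(h,G)$, then $M$ almost surely has continuous paths and, considered (after modification on a null event) as a random element of $C(\mathbb R^d,[0,\infty])$ with the topology of uniform convergence on compact sets and its Borel $\sigma$-field, it is stationary and $\alpha$-mixing, hence ergodic. -/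

import Mathlib

open MeasureTheory ProbabilityTheory Filter Topology Set
open scoped ENNReal NNReal

noncomputable section

namespace ShotNoise

/-- The Euclidean space `ℝ^d`. -/
abbrev E (d : ℕ) : Type := EuclideanSpace ℝ (Fin d)

/-- The half-line `(0, +∞)` of weights. -/
abbrev Weight : Type := Set.Ioi (0 : ℝ)

/-- The number of points of the configuration `N` lying in `B`. -/
def count {S : Type*} (N B : Set S) : ℕ∞ := (N ∩ B).encard

/-- `Φ` is a (simple) Poisson point process on `S` with intensity measure `ν`, defined on the
probability space `(Ω, P)`: a random locally finite subset of `S` whose numbers of points in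
Borel sets are measurable, Poisson distributed with mean `ν B` (a.s. infinite when `ν B = ∞`),
and independent for pairwise disjoint Borel sets. -/
structure IsPoissonPointProcess {Ω S : Type*} [MeasurableSpace Ω] [TopologicalSpace S]
    [MeasurableSpace S] (Φ : Ω → Set S) (ν : Measure S) (P : Measure Ω) : Prop where
  locallyFinite : ∀ ω, ∀ K : Set S, IsCompact K → (Φ ω ∩ K).Finite
  measurable_count : ∀ B : Set S, MeasurableSet B → Measurable fun ω => count (Φ ω) B
  law_count : ∀ B : Set S, MeasurableSet B → ν B ≠ ∞ →
    P.map (fun ω => count (Φ ω) B) = (poissonMeasure (ν B).toNNReal).map (Nat.cast : ℕ → ℕ∞)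
  count_eq_top : ∀ B : Set S, MeasurableSet B → ν B = ∞ → ∀ᵐ ω ∂P, count (Φ ω) B = ⊤
  indep : ∀ (n : ℕ) (B : Fin n → Set S), (∀ i, MeasurableSet (B i)) →
    Pairwise (fun i j => Disjoint (B i) (B j)) →
    iIndepFun (fun i ω => count (Φ ω) (B i)) P

/-- The extremal shot noise field `M(y) = sup {m h(y - x) ; (x, m) ∈ N}` of a configuration `N`
(the supremum of the empty set is `0`). -/
def shotNoise {d : ℕ} (h : E d → ℝ≥0∞) (N : Set (E d × Weight)) (y : E d) : ℝ≥0∞ :=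
  ⨆ φ ∈ N, ENNReal.ofReal (φ.2 : ℝ) * h (y - φ.1)

/-- The tail function `u ↦ G((u, +∞))`, for `u ∈ [0, +∞]`. -/
def tail (G : Measure Weight) (u : ℝ≥0∞) : ℝ≥0∞ :=
  G {m | u < ENNReal.ofReal (m : ℝ)}

/-- The coefficient `α(h, G)`, the infimum of all `u ∈ (0, +∞)` for which
`∫ tail G (u / h(x)) dx < ∞`; it is `+∞` if there is no such `u`. In `[0, +∞]`, for
`0 < u < +∞`, one has `u / 0 = +∞` and `u / +∞ = 0`, so that the integrand is `0` where `h = 0`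
and `G((0, +∞))` where `h = +∞`. -/
def alpha {d : ℕ} (h : E d → ℝ≥0∞) (G : Measure Weight) : ℝ≥0∞ :=
  sInf {u : ℝ≥0∞ | 0 < u ∧ u < ∞ ∧ ∫⁻ x, tail G (u / h x) < ∞}

/-- `h⁺(x) = sup {h(x + z) ; |z| ≤ 1}`. -/
def hPlus {d : ℕ} (h : E d → ℝ≥0∞) (x : E d) : ℝ≥0∞ :=
  ⨆ z ∈ {z : E d | ‖z‖ ≤ 1}, h (x + z)

/-- `α⁺(h, G) = α(h⁺, G)`. -/
def alphaPlus {d : ℕ} (h : E d → ℝ≥0∞) (G : Measure Weight) : ℝ≥0∞ :=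
  alpha (hPlus h) G

/-- `h⁻_ε(x) = inf {h(x + z) ; |z| ≤ ε}`. -/
def hMinus {d : ℕ} (h : E d → ℝ≥0∞) (ε : ℝ) (x : E d) : ℝ≥0∞ :=
  ⨅ z ∈ {z : E d | ‖z‖ ≤ ε}, h (x + z)

/-- `α⁻(h, G)`, the limit of `α(h⁻_ε, G)` as `ε ↓ 0`. The function of `ε` is nonincreasing, so
the limit is a supremum; see `tendsto_alphaMinus`. -/
def alphaMinus {d : ℕ} (h : E d → ℝ≥0∞) (G : Measure Weight) : ℝ≥0∞ :=
  ⨆ ε ∈ Set.Ioi (0 : ℝ), alpha (hMinus h ε) G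

theorem alpha_mono {d : ℕ} {h₁ h₂ : E d → ℝ≥0∞} (hle : ∀ x, h₁ x ≤ h₂ x) (G : Measure Weight) :
    alpha h₁ G ≤ alpha h₂ G := by
  refine sInf_le_sInf ?_
  rintro u ⟨h0, h1, h2⟩
  refine ⟨h0, h1, lt_of_le_of_lt (lintegral_mono fun x => ?_) h2⟩
  exact measure_mono fun m hm => lt_of_le_of_lt (ENNReal.div_le_div_left (hle x) u) hm

theorem tendsto_alphaMinus {d : ℕ} (h : E d → ℝ≥0∞) (G : Measure Weight) :
    Tendsto (fun ε : ℝ => alpha (hMinus h ε) G) (𝓝[>] 0) (𝓝 (alphaMinus h G)) := by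
  have hanti : Antitone fun ε : ℝ => alpha (hMinus h ε) G := fun a b hab =>
    alpha_mono (fun x => biInf_mono fun z (hz : ‖z‖ ≤ a) => hz.trans hab) G
  have := hanti.tendsto_nhdsGT 0
  rwa [sSup_image] at this

/-- The Borel `σ`-field of `C(ℝ^d, [0, +∞])`, for the topology of uniform convergence on compact
sets (the compact-open topology). The space `ℝ^d → [0, +∞]` carries the product `σ`-field. -/
instance instMeasurableSpaceC (d : ℕ) : MeasurableSpace C(E d, ℝ≥0∞) := borel _

instance instBorelSpaceC (d : ℕ) : BorelSpace C(E d, ℝ≥0∞) := ⟨rfl⟩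

/-- The shift `τ_v f = f(· + v)` on `[0, +∞]^{ℝ^d}`. -/
def shift {d : ℕ} (v : E d) (f : E d → ℝ≥0∞) : E d → ℝ≥0∞ := fun y => f (y + v)

/-- The shift `τ_v f = f(· + v)` on `C(ℝ^d, [0, +∞])`. -/
def shiftC {d : ℕ} (v : E d) (f : C(E d, ℝ≥0∞)) : C(E d, ℝ≥0∞) :=
  ⟨fun y => f (y + v), by fun_prop⟩

/-- `M` is a random element of the measurable space `X` whose law is invariant under all the
shifts `τ v`, `v ∈ ℝ^d`. -/
structure IsStationary {d : ℕ} {Ω X : Type*} [MeasurableSpace Ω] [MeasurableSpace X]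
    (τ : E d → X → X) (M : Ω → X) (P : Measure Ω) : Prop where
  measurable : Measurable M
  measurable_shift : ∀ v, Measurable fun ω => τ v (M ω)
  map_shift : ∀ v, P.map (fun ω => τ v (M ω)) = P.map M

/-- The stationary random element `M` is `α`-mixing:
`P(M ∈ A, τ_v M ∈ B) → P(M ∈ A) P(M ∈ B)` as `|v| → ∞`, for all measurable `A, B`. -/
structure IsAlphaMixing {d : ℕ} {Ω X : Type*} [MeasurableSpace Ω] [MeasurableSpace X]
    (τ : E d → X → X) (M : Ω → X) (P : Measure Ω) : Prop extends IsStationary τ M P where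
  mixing : ∀ A B : Set X, MeasurableSet A → MeasurableSet B →
    Tendsto (fun v : E d => P {ω | M ω ∈ A ∧ τ v (M ω) ∈ B}) (Bornology.cobounded (E d))
      (𝓝 (P {ω | M ω ∈ A} * P {ω | M ω ∈ B}))

/-- The stationary random element `M` is ergodic: every measurable set that is almost surely
invariant under each of the shifts has probability `0` or `1` under the law of `M`. -/
structure IsErgodic {d : ℕ} {Ω X : Type*} [MeasurableSpace Ω] [MeasurableSpace X]
    (τ : E d → X → X) (M : Ω → X) (P : Measure Ω) : Prop extends IsStationary τ M P where
  zero_one : ∀ A : Set X, MeasurableSet A →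
    (∀ v : E d, ∀ᵐ ω ∂P, (τ v (M ω) ∈ A ↔ M ω ∈ A)) →
    P {ω | M ω ∈ A} = 0 ∨ P {ω | M ω ∈ A} = 1

end ShotNoise

end

/-!
The event that the extremal shot noise stays below given levels at finitely many sites says that
the Poisson process has no point in a certain set `D`, so it has probability `exp (-ν D)`, where
`ν` is the intensity. Shifting the field translates `D`, and `ν (C ∪ (D + v)) → ν C + ν D` as
`|v| → ∞`; hence such events are asymptotically independent. They form a `π`-system generating the
product `σ`-field, and asymptotic independence passes to the generated `σ`-field.

For the paths, `∫ tail G (u / h)` is the intensity of the points contributing more than `u` at a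
given site. It is infinite for `u < α(h, G)` and finite for `u > α(h, G)`. Hence `M ≥ α⁻`
everywhere, while above the level `α⁺` only finitely many points contribute locally. If `α⁺ ≤ α⁻`,
then `M` is near each site, at every level above its value there, a supremum of finitely many
continuous functions. Finally the Borel `σ`-field of `C(ℝ^d, [0, ∞])` is the trace of the product
`σ`-field, so that mixing carries over to the continuous version.
-/

namespace ShotNoise

section ContinuousMap

variable {X Y : Type*} [TopologicalSpace X] [TopologicalSpace Y]

theorem exists_finite_subset_basis_closure_cover [RegularSpace Y] {B : Set (Set Y)}
    (hB : TopologicalSpace.IsTopologicalBasis B) {K U : Set Y} (hK : IsCompact K) (hU : IsOpen U)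
    (hKU : K ⊆ U) : ∃ s ⊆ B, s.Finite ∧ K ⊆ ⋃ V ∈ s, closure V ∧ ⋃ V ∈ s, closure V ⊆ U := by
  obtain ⟨s, hs, hfin, hcover⟩ := hK.elim_finite_subcover_image
    (b := {V ∈ B | closure V ⊆ U}) (c := id) (fun V hV => hB.isOpen hV.1) fun x hx => by
      obtain ⟨V, hV, hxV, hVU⟩ := hB.exists_closure_subset (hU.mem_nhds (hKU hx))
      exact mem_biUnion (show V ∈ {V ∈ B | closure V ⊆ U} from ⟨hV, hVU⟩) hxV
  exact ⟨s, fun V hV => (hs hV).1, hfin,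
    hcover.trans (iUnion₂_mono fun V _ => subset_closure), iUnion₂_subset fun V hV => (hs hV).2⟩

variable [SecondCountableTopology X] [MeasurableSpace Y]

theorem measurableSet_comap_coe_mapsTo_isClosed [OpensMeasurableSpace Y] (K : Set X) {F : Set Y}
    (hF : IsClosed F) :
    MeasurableSet[MeasurableSpace.comap ((⇑) : C(X, Y) → X → Y) MeasurableSpace.pi]
      {f : C(X, Y) | MapsTo f K F} := by
  obtain ⟨D, hDc, hDd⟩ := TopologicalSpace.exists_countable_dense K
  refine ⟨⋂ x ∈ D, Function.eval (x : X) ⁻¹' F, MeasurableSet.biInter hDc fun x _ =>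
    measurable_pi_apply _ hF.measurableSet, ?_⟩
  ext f
  simp only [mem_preimage, mem_iInter, Function.eval]
  refine ⟨fun hD x hx => ?_, fun hK x _ => hK x.2⟩
  have hclosed : IsClosed {x : K | f x ∈ F} :=
    hF.preimage (f.continuous.comp continuous_subtype_val)
  exact closure_minimal hD hclosed (hDd ⟨x, hx⟩)

theorem measurableSet_comap_coe_mapsTo_isOpen [SecondCountableTopology Y] [RegularSpace Y]
    [OpensMeasurableSpace Y] {K : Set X} (hK : IsCompact K) {U : Set Y} (hU : IsOpen U) :
    MeasurableSet[MeasurableSpace.comap ((⇑) : C(X, Y) → X → Y) MeasurableSpace.pi]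
      {f : C(X, Y) | MapsTo f K U} := by
  set 𝒮 : Set (Set (Set Y)) :=
    {s | (s.Finite ∧ s ⊆ TopologicalSpace.countableBasis Y) ∧ ⋃ V ∈ s, closure V ⊆ U}
  have h𝒮 : 𝒮.Countable :=
    (countable_ofPred_finite_subset (TopologicalSpace.countable_countableBasis Y)).mono
      fun s hs => hs.1
  have hunion : {f : C(X, Y) | MapsTo f K U} =
      ⋃ s ∈ 𝒮, {f : C(X, Y) | MapsTo f K (⋃ V ∈ s, closure V)} := by
    ext f
    simp only [mem_iUnion, exists_prop]
    refine ⟨fun hf => ?_, fun ⟨s, hs, hf⟩ => hf.mono_right hs.2⟩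
    obtain ⟨s, hsB, hfin, hcover, hsU⟩ := exists_finite_subset_basis_closure_cover
      (TopologicalSpace.isBasis_countableBasis Y) (hK.image f.continuous) hU hf.image_subset
    exact ⟨s, ⟨⟨hfin, hsB⟩, hsU⟩, mapsTo_iff_image_subset.2 hcover⟩
  rw [hunion]
  exact MeasurableSet.biUnion h𝒮 fun s hs => measurableSet_comap_coe_mapsTo_isClosed K
    (hs.1.1.isClosed_biUnion fun _ _ => isClosed_closure)

theorem borel_continuousMap_eq_comap_coe [LocallyCompactSpace X] [SecondCountableTopology Y]
    [RegularSpace Y] [BorelSpace Y] :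
    borel C(X, Y) = MeasurableSpace.comap ((⇑) : C(X, Y) → X → Y) MeasurableSpace.pi := by
  apply le_antisymm
  · rw [borel_eq_generateFrom_of_subbasis (ContinuousMap.compactOpen_eq (X := X) (Y := Y))]
    refine MeasurableSpace.generateFrom_le ?_
    rintro _ ⟨K, hK, U, hU, rfl⟩
    exact measurableSet_comap_coe_mapsTo_isOpen hK hU
  · let _ : MeasurableSpace C(X, Y) := borel _
    have : BorelSpace C(X, Y) := ⟨rfl⟩
    exact Measurable.comap_le (measurable_pi_lambda _ fun x => (continuous_eval_const x).measurable)

end ContinuousMap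

section SquareCylinders

variable {ι : Type*} {α : ι → Type*}

theorem generateFrom_squareCylinders_of_generateFrom [m : ∀ i, MeasurableSpace (α i)]
    {C : ∀ i, Set (Set (α i))} (hgen : ∀ i, MeasurableSpace.generateFrom (C i) = m i)
    (hne : ∀ i, (C i).Nonempty) :
    MeasurableSpace.generateFrom (squareCylinders C) = MeasurableSpace.pi := by
  classical
  apply le_antisymm
  · refine MeasurableSpace.generateFrom_le ?_
    rintro _ ⟨s, t, ht, rfl⟩
    exact MeasurableSet.pi s.countable_toSet fun i _ =>
      hgen i ▸ MeasurableSpace.measurableSet_generateFrom (ht i trivial)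
  · choose t₀ ht₀ using hne
    refine iSup_le fun i => ?_
    rw [← hgen i, MeasurableSpace.comap_generateFrom]
    refine MeasurableSpace.generateFrom_mono ?_
    rintro _ ⟨A, hA, rfl⟩
    refine ⟨{i}, Function.update t₀ i A, fun j _ => ?_, by simp⟩
    obtain rfl | hj := eq_or_ne j i
    · simpa using hA
    · simpa [hj] using ht₀ j

theorem forall_mem_squareCylinders_range {β : ι → Type*} {g : ∀ i, β i → Set (α i)}
    {p : Set (∀ i, α i) → Prop} :
    (∀ A ∈ squareCylinders fun i => range (g i), p A) ↔
      ∀ (F : Finset ι) (t : ∀ i, β i), p ((F : Set ι).pi fun i => g i (t i)) := by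
  refine ⟨fun H F t => H _ ⟨F, _, fun i _ => mem_range_self (t i), rfl⟩, ?_⟩
  rintro H _ ⟨F, T, hT, rfl⟩
  choose t ht using fun i => hT i trivial
  obtain rfl : (fun i => g i (t i)) = T := funext ht
  exact H F t

variable (S Y : Type*) [LinearOrder Y] [OrderTop Y]

theorem isPiSystem_squareCylinders_Iic :
    IsPiSystem (squareCylinders fun _ : S => range (Iic : Y → Set Y)) :=
  isPiSystem_squareCylinders (fun _ => image_univ ▸ isPiSystem_image_Iic (univ : Set Y))
    fun _ => ⟨⊤, Iic_top⟩

theorem generateFrom_squareCylinders_Iic [TopologicalSpace Y] [OrderTopology Y]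
    [SecondCountableTopology Y] [MeasurableSpace Y] [BorelSpace Y] :
    MeasurableSpace.generateFrom (squareCylinders fun _ : S => range (Iic : Y → Set Y)) =
      MeasurableSpace.pi :=
  generateFrom_squareCylinders_of_generateFrom
    (fun _ => (borel_eq_generateFrom_Iic Y).symm.trans BorelSpace.measurable_eq.symm)
    fun _ => ⟨_, mem_range_self ⊤⟩

end SquareCylinders

section AsymptoticIndependence

theorem hasSum_measureReal_iUnion {X : Type*} [MeasurableSpace X] {μ : Measure X}
    [IsFiniteMeasure μ] {f : ℕ → Set X} (hf : ∀ n, MeasurableSet (f n))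
    (hdisj : Pairwise (Function.onFun Disjoint f)) :
    HasSum (fun n => μ.real (f n)) (μ.real (⋃ n, f n)) := by
  have hsum := measure_iUnion (μ := μ) hdisj hf
  rw [measureReal_def, hsum, ENNReal.tsum_toReal_eq fun _ => measure_ne_top _ _]
  exact ENNReal.hasSum_toReal (hsum ▸ measure_ne_top _ _)

variable {Ω X Y ι : Type*} [MeasurableSpace Ω] [mX : MeasurableSpace X] [mY : MeasurableSpace Y]
  {P : Measure Ω} [IsProbabilityMeasure P] {μ : Measure X} {κ : Measure Y} {l : Filter ι}
  {U : ι → Ω → X} {V : ι → Ω → Y}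

theorem tendsto_measureReal_preimage_inter_of_isPiSystem {S : Set (Set X)}
    (hgen : MeasurableSpace.generateFrom S = mX) (hS : IsPiSystem S)
    (hU : ∀ i, MeasurePreserving (U i) P μ) {B : ι → Set Ω} (hB : ∀ i, MeasurableSet (B i)) {c : ℝ}
    (hc : Tendsto (fun i => P.real (B i)) l (𝓝 c))
    (hind : ∀ A ∈ S, Tendsto (fun i => P.real (U i ⁻¹' A ∩ B i)) l (𝓝 (μ.real A * c)))
    {A : Set X} (hA : MeasurableSet A) :
    Tendsto (fun i => P.real (U i ⁻¹' A ∩ B i)) l (𝓝 (μ.real A * c)) := by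
  obtain hι | ⟨⟨i₀⟩⟩ := isEmpty_or_nonempty ι
  · simp [filter_eq_bot_of_isEmpty l]
  have : IsProbabilityMeasure μ := (hU i₀).map_eq ▸
    Measure.isProbabilityMeasure_map (hU i₀).aemeasurable
  induction A, hA using MeasurableSpace.induction_on_inter hgen.symm hS with
  | empty => simpa using tendsto_const_nhds
  | basic A hA => exact hind A hA
  | compl A hA ih =>
    have hdiff (i : ι) : P.real (U i ⁻¹' Aᶜ ∩ B i) = P.real (B i) - P.real (U i ⁻¹' A ∩ B i) := by
      rw [preimage_compl, inter_comm, ← Set.sdiff_eq, inter_comm _ (B i), eq_sub_iff_add_eq]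
      exact measureReal_sdiff_add_inter ((hU i).measurable hA)
    simp_rw [hdiff, probReal_compl_eq_one_sub hA, sub_mul, one_mul]
    exact hc.sub ih
  | iUnion A hdisj hA ih =>
    have hsum := hasSum_measureReal_iUnion (μ := μ) hA hdisj
    have hsum_inter (i : ι) :
        P.real (U i ⁻¹' (⋃ n, A n) ∩ B i) = ∑' n, P.real (U i ⁻¹' A n ∩ B i) := by
      rw [preimage_iUnion, iUnion_inter]
      exact (hasSum_measureReal_iUnion (fun n => ((hU i).measurable (hA n)).inter (hB i))
        fun m n hmn => ((hdisj hmn).preimage (U i)).mono inter_subset_left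
          inter_subset_left).tsum_eq.symm
    simp_rw [hsum_inter, ← (hsum.mul_right c).tsum_eq]
    refine tendsto_tsum_of_dominated_convergence hsum.summable ih (.of_forall fun i n => ?_)
    rw [Real.norm_of_nonneg measureReal_nonneg,
      ← (hU i).measureReal_preimage (hA n).nullMeasurableSet]
    exact measureReal_mono inter_subset_left

theorem tendsto_measureReal_preimage_inter_preimage_of_isPiSystem {S : Set (Set X)}
    {T : Set (Set Y)} (hgenS : MeasurableSpace.generateFrom S = mX) (hS : IsPiSystem S)
    (hgenT : MeasurableSpace.generateFrom T = mY) (hT : IsPiSystem T)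
    (hU : ∀ i, MeasurePreserving (U i) P μ) (hV : ∀ i, MeasurePreserving (V i) P κ)
    (hind : ∀ A ∈ S, ∀ B ∈ T,
      Tendsto (fun i => P.real (U i ⁻¹' A ∩ V i ⁻¹' B)) l (𝓝 (μ.real A * κ.real B)))
    {A : Set X} (hA : MeasurableSet A) {B : Set Y} (hB : MeasurableSet B) :
    Tendsto (fun i => P.real (U i ⁻¹' A ∩ V i ⁻¹' B)) l (𝓝 (μ.real A * κ.real B)) := by
  have hlawU {A : Set X} (hA : MeasurableSet A) :
      Tendsto (fun i => P.real (U i ⁻¹' A)) l (𝓝 (μ.real A)) := by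
    simp only [fun i => (hU i).measureReal_preimage hA.nullMeasurableSet, tendsto_const_nhds]
  have hlawV {B : Set Y} (hB : MeasurableSet B) :
      Tendsto (fun i => P.real (V i ⁻¹' B)) l (𝓝 (κ.real B)) := by
    simp only [fun i => (hV i).measureReal_preimage hB.nullMeasurableSet, tendsto_const_nhds]
  have hleft (B : Set Y) (hB : B ∈ T) :
      Tendsto (fun i => P.real (U i ⁻¹' A ∩ V i ⁻¹' B)) l (𝓝 (μ.real A * κ.real B)) := by
    have hBm : MeasurableSet B := hgenT ▸ .basic B hB
    exact tendsto_measureReal_preimage_inter_of_isPiSystem hgenS hS hU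
      (fun i => (hV i).measurable hBm) (hlawV hBm) (fun A hA => hind A hA B hB) hA
  simp only [inter_comm (U _ ⁻¹' _), mul_comm (μ.real A)] at hleft ⊢
  exact tendsto_measureReal_preimage_inter_of_isPiSystem hgenT hT hV
    (fun i => (hU i).measurable hA) (hlawU hA) hleft hB

end AsymptoticIndependence

section Mixing

variable {d : ℕ} {Ω X : Type*} [MeasurableSpace Ω] [mX : MeasurableSpace X] {P : Measure Ω}
  {τ : E d → X → X} {M : Ω → X}

theorem IsStationary.measurePreserving (hM : IsStationary τ M P) :
    MeasurePreserving M P (P.map M) :=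
  hM.measurable.measurePreserving P

theorem IsStationary.measurePreserving_shift (hM : IsStationary τ M P) (v : E d) :
    MeasurePreserving (fun ω => τ v (M ω)) P (P.map M) :=
  ⟨hM.measurable_shift v, hM.map_shift v⟩

theorem IsStationary.isAlphaMixing_of_isPiSystem [IsProbabilityMeasure P] (hM : IsStationary τ M P)
    {S : Set (Set X)} (hgen : MeasurableSpace.generateFrom S = mX) (hS : IsPiSystem S)
    (hmix : ∀ A ∈ S, ∀ B ∈ S, Tendsto (fun v => P {ω | M ω ∈ A ∧ τ v (M ω) ∈ B})
      (Bornology.cobounded (E d)) (𝓝 (P {ω | M ω ∈ A} * P {ω | M ω ∈ B}))) :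
    IsAlphaMixing τ M P := by
  have htoReal (A B : Set X) :
      Tendsto (fun v => P {ω | M ω ∈ A ∧ τ v (M ω) ∈ B}) (Bornology.cobounded (E d))
          (𝓝 (P {ω | M ω ∈ A} * P {ω | M ω ∈ B})) ↔
        Tendsto (fun v => P.real (M ⁻¹' A ∩ (fun ω => τ v (M ω)) ⁻¹' B))
          (Bornology.cobounded (E d)) (𝓝 (P.real (M ⁻¹' A) * P.real (M ⁻¹' B))) := by
    rw [← ENNReal.tendsto_toReal_iff (fun _ => measure_ne_top _ _)
      (ENNReal.mul_ne_top (measure_ne_top _ _) (measure_ne_top _ _)), ENNReal.toReal_mul]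
    rfl
  have hlaw {A : Set X} (hA : MeasurableSet A) : P.real (M ⁻¹' A) = (P.map M).real A :=
    (map_measureReal_apply hM.measurable hA).symm
  have hSm {A : Set X} (hA : A ∈ S) : MeasurableSet A := hgen ▸ .basic A hA
  refine ⟨hM, fun A B hA hB => ?_⟩
  rw [htoReal, hlaw hA, hlaw hB]
  refine tendsto_measureReal_preimage_inter_preimage_of_isPiSystem hgen hS hgen hS
    (fun _ => hM.measurePreserving) hM.measurePreserving_shift (fun A hA B hB => ?_) hA hB
  rw [← hlaw (hSm hA), ← hlaw (hSm hB), ← htoReal]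
  exact hmix A hA B hB

theorem IsAlphaMixing.isErgodic [IsFiniteMeasure P] (hd : 1 ≤ d) (hM : IsAlphaMixing τ M P) :
    IsErgodic τ M P := by
  refine ⟨hM.toIsStationary, fun A hA hinv => ?_⟩
  have : Nonempty (Fin d) := ⟨⟨0, hd⟩⟩
  have hconst (v : E d) : P {ω | M ω ∈ A ∧ τ v (M ω) ∈ A} = P {ω | M ω ∈ A} :=
    measure_congr <| by
      filter_upwards [hinv v] with ω hω
      exact propext (and_iff_left_of_imp hω.2)
  have hlim := hM.mixing A A hA hA
  simp_rw [hconst] at hlim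
  have hidem : P {ω | M ω ∈ A} = P {ω | M ω ∈ A} * P {ω | M ω ∈ A} :=
    tendsto_nhds_unique tendsto_const_nhds hlim
  exact or_iff_not_imp_left.2 fun h0 => (ENNReal.mul_eq_left h0 (measure_ne_top _ _)).1 hidem.symm

theorem IsAlphaMixing.congr (hτ : ∀ v, Measurable (τ v)) {N : Ω → X} (hM : IsAlphaMixing τ M P)
    (hN : Measurable N) (hMN : M =ᵐ[P] N) : IsAlphaMixing τ N P where
  measurable := hN
  measurable_shift v := (hτ v).comp hN
  map_shift v := by
    rw [← Measure.map_congr hMN, ← hM.map_shift v]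
    exact (Measure.map_congr (hMN.fun_comp (τ v))).symm
  mixing A B hA hB := by
    have hlaw (A : Set X) : P {ω | M ω ∈ A} = P {ω | N ω ∈ A} :=
      measure_congr (hMN.fun_comp (· ∈ A))
    have hjoint (v : E d) :
        P {ω | M ω ∈ A ∧ τ v (M ω) ∈ B} = P {ω | N ω ∈ A ∧ τ v (N ω) ∈ B} :=
      measure_congr (hMN.fun_comp fun f => f ∈ A ∧ τ v f ∈ B)
    simpa only [hlaw, hjoint] using hM.mixing A B hA hB

theorem IsAlphaMixing.of_comap {Z : Type*} [mZ : MeasurableSpace Z] {e : Z → X}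
    (he : mZ = MeasurableSpace.comap e mX) {σ : E d → Z → Z} (hσ : ∀ v z, e (σ v z) = τ v (e z))
    {N : Ω → Z} (hN : IsAlphaMixing τ (fun ω => e (N ω)) P) : IsAlphaMixing σ N P := by
  have hpre {A : Set X} (hA : MeasurableSet A) : MeasurableSet (e ⁻¹' A) := he ▸ ⟨A, hA, rfl⟩
  have hset {B : Set Z} (hB : MeasurableSet B) : ∃ A, MeasurableSet A ∧ e ⁻¹' A = B := by
    rwa [he] at hB
  have hmeas {f : Ω → Z} (hf : Measurable fun ω => e (f ω)) : Measurable f := fun B hB => by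
    obtain ⟨A, hA, rfl⟩ := hset hB
    exact hf hA
  have hNm : Measurable N := hmeas hN.measurable
  have hNσ (v : E d) : Measurable fun ω => σ v (N ω) :=
    hmeas (by simpa only [hσ] using hN.measurable_shift v)
  refine ⟨⟨hNm, hNσ, fun v => Measure.ext fun B hB => ?_⟩, fun B B' hB hB' => ?_⟩
  · obtain ⟨A, hA, rfl⟩ := hset hB
    have hlaw := congrArg (fun μ : Measure X => μ A) (hN.map_shift v)
    simp only [Measure.map_apply (hN.measurable_shift v) hA, Measure.map_apply hN.measurable hA]
      at hlaw
    rw [Measure.map_apply (hNσ v) (hpre hA), Measure.map_apply hNm (hpre hA)]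
    simpa only [preimage_preimage, hσ] using hlaw
  · obtain ⟨A, hA, rfl⟩ := hset hB
    obtain ⟨A', hA', rfl⟩ := hset hB'
    simpa only [mem_preimage, hσ] using hN.mixing A A' hA hA'

theorem measurable_shift (v : E d) : Measurable (shift v) :=
  measurable_pi_lambda _ fun y => measurable_pi_apply (y + v)

theorem IsAlphaMixing.exists_continuousMap {M : Ω → E d → ℝ≥0∞} (hM : IsAlphaMixing shift M P)
    (hcont : ∀ᵐ ω ∂P, Continuous (M ω)) :
    ∃ M' : Ω → C(E d, ℝ≥0∞), (∀ᵐ ω ∂P, ⇑(M' ω) = M ω) ∧ IsAlphaMixing shiftC M' P := by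
  obtain ⟨N, hN, hNcont, hMN⟩ := hM.measurable.aemeasurable.exists_ae_eq_range_subset
    (t := {f | Continuous f}) hcont ⟨0, continuous_zero⟩
  exact ⟨fun ω => ⟨N ω, hNcont (mem_range_self ω)⟩, hMN.symm,
    (hM.congr measurable_shift hN hMN).of_comap borel_continuousMap_eq_comap_coe fun _ _ => rfl⟩

end Mixing

section PoissonPointProcess

theorem count_eq_zero_iff {S : Type*} {N B : Set S} : count N B = 0 ↔ Disjoint N B := by
  rw [count, encard_eq_zero, disjoint_iff_inter_eq_empty]

variable {Ω S : Type*} [MeasurableSpace Ω] [TopologicalSpace S] [MeasurableSpace S]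
  {Φ : Ω → Set S} {ν : Measure S} {P : Measure Ω} {B : Set S}

theorem IsPoissonPointProcess.measure_count_eq_zero (hΦ : IsPoissonPointProcess Φ ν P)
    (hB : MeasurableSet B) : P {ω | count (Φ ω) B = 0} = EReal.exp (-(ν B : EReal)) := by
  by_cases hν : ν B = ∞
  · rw [hν, EReal.coe_ennreal_top, EReal.neg_top, EReal.exp_bot]
    refine measure_mono_null (fun ω (hω : _ = _) => ?_) (ae_iff.1 (hΦ.count_eq_top B hB hν))
    simp [hω]
  · have hsingle : (Nat.cast : ℕ → ℕ∞) ⁻¹' {0} = {0} := by ext; simp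
    calc P {ω | count (Φ ω) B = 0} = P.map (fun ω => count (Φ ω) B) {0} :=
          (Measure.map_apply (hΦ.measurable_count B hB) (measurableSet_singleton 0)).symm
      _ = poissonMeasure (ν B).toNNReal {0} := by
          rw [hΦ.law_count B hB hν, Measure.map_apply .of_discrete (measurableSet_singleton 0),
            hsingle]
      _ = EReal.exp (-(ν B : EReal)) := by
          lift ν B to ℝ≥0 using hν with r
          rw [EReal.coe_nnreal_eq_coe_real, ← EReal.coe_neg, EReal.exp_coe]
          simp [poissonMeasure_singleton]

theorem IsPoissonPointProcess.ae_finite_inter (hΦ : IsPoissonPointProcess Φ ν P)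
    (hB : MeasurableSet B) (hν : ν B ≠ ∞) : ∀ᵐ ω ∂P, (Φ ω ∩ B).Finite := by
  have htop : (Nat.cast : ℕ → ℕ∞) ⁻¹' {⊤} = ∅ := by ext; simp
  have hcount : ∀ᵐ n ∂P.map (fun ω => count (Φ ω) B), n ≠ ⊤ := by
    rw [hΦ.law_count B hB hν, ae_iff]
    simp [Measure.map_apply .of_discrete (measurableSet_singleton _), htop]
  filter_upwards [ae_of_ae_map (hΦ.measurable_count B hB).aemeasurable hcount] with ω hω
  exact encard_ne_top_iff.1 hω

end PoissonPointProcess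

section Translate

variable {V W : Type*} [NormedAddCommGroup V]

/-- The translate by `v`, in the space variable only, of a set `D` of marked points. -/
def translate (v : V) (D : Set (V × W)) : Set (V × W) :=
  {q | (q.1 - v, q.2) ∈ D}

variable [MeasurableSpace V] [MeasurableSpace W]

theorem tendsto_measure_inter_lt_norm_fst [OpensMeasurableSpace V] {ν : Measure (V × W)}
    {C : Set (V × W)} (hC : MeasurableSet C) (hν : ν C ≠ ∞) :
    Tendsto (fun n : ℕ => ν (C ∩ {q | (n : ℝ) < ‖q.1‖})) atTop (𝓝 0) := by
  have hempty : ⋂ n : ℕ, C ∩ {q | (n : ℝ) < ‖q.1‖} = ∅ := by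
    refine eq_empty_of_forall_notMem fun q hq => ?_
    obtain ⟨n, hn⟩ := exists_nat_ge ‖q.1‖
    exact hn.not_gt (mem_iInter.1 hq n).2
  rw [← measure_empty (μ := ν), ← hempty]
  refine tendsto_measure_iInter_atTop (fun n => (hC.inter (measurableSet_lt measurable_const
      measurable_fst.norm)).nullMeasurableSet) (fun m n hmn => ?_)
    ⟨0, measure_ne_top_of_subset inter_subset_left hν⟩
  exact inter_subset_inter_right C fun q (hq : (n : ℝ) < _) => (Nat.cast_le.2 hmn).trans_lt hq

variable [MeasurableAdd V] (μ : Measure V) [SFinite μ] [μ.IsAddRightInvariant]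
  (G : Measure W) [SFinite G] {C D : Set (V × W)}

theorem measurePreserving_sub_fst (v : V) :
    MeasurePreserving (fun q : V × W => (q.1 - v, q.2)) (μ.prod G) (μ.prod G) :=
  (measurePreserving_sub_right μ v).prod (.id G)

theorem measurableSet_translate (hD : MeasurableSet D) (v : V) : MeasurableSet (translate v D) := by
  simp only [translate, sub_eq_add_neg]
  exact ((measurable_fst.add_const (-v)).prodMk measurable_snd) hD

theorem measure_translate (hD : MeasurableSet D) (v : V) :
    μ.prod G (translate v D) = μ.prod G D :=
  (measurePreserving_sub_fst μ G v).measure_preimage hD.nullMeasurableSet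

theorem tendsto_measure_inter_translate [OpensMeasurableSpace V] (hC : MeasurableSet C)
    (hD : MeasurableSet D) (hCν : μ.prod G C ≠ ∞) (hDν : μ.prod G D ≠ ∞) :
    Tendsto (fun v => μ.prod G (C ∩ translate v D)) (Bornology.cobounded V) (𝓝 0) := by
  refine ENNReal.tendsto_nhds_zero.2 fun ε hε => ?_
  set far : ℕ → Set (V × W) := fun n => {q | (n : ℝ) < ‖q.1‖}
  have hsum := (tendsto_measure_inter_lt_norm_fst hC hCν).add
    (tendsto_measure_inter_lt_norm_fst hD hDν)
  rw [add_zero] at hsum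
  obtain ⟨n, hn⟩ := (ENNReal.tendsto_nhds_zero.1 hsum ε hε).exists
  filter_upwards [tendsto_norm_cobounded_atTop.eventually_gt_atTop (2 * n : ℝ)] with v hv
  have hsub : C ∩ translate v D ⊆ (C ∩ far n) ∪ translate v (D ∩ far n) := by
    rintro q ⟨hqC, hqD⟩
    by_cases hq : (n : ℝ) < ‖q.1‖
    · exact .inl ⟨hqC, hq⟩
    · have hnorm : ‖v‖ ≤ ‖q.1‖ + ‖q.1 - v‖ := by simpa using norm_sub_le q.1 (q.1 - v)
      exact .inr ⟨hqD, show (n : ℝ) < ‖q.1 - v‖ by linarith⟩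
  calc μ.prod G (C ∩ translate v D)
      ≤ μ.prod G (C ∩ far n) + μ.prod G (translate v (D ∩ far n)) :=
        (measure_mono hsub).trans (measure_union_le _ _)
    _ = μ.prod G (C ∩ far n) + μ.prod G (D ∩ far n) := by
        rw [measure_translate μ G
          (hD.inter (measurableSet_lt measurable_const measurable_fst.norm)) v]
    _ ≤ ε := hn

theorem tendsto_measure_union_translate [OpensMeasurableSpace V] (hC : MeasurableSet C)
    (hD : MeasurableSet D) :
    Tendsto (fun v => μ.prod G (C ∪ translate v D)) (Bornology.cobounded V)
      (𝓝 (μ.prod G C + μ.prod G D)) := by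
  by_cases hCν : μ.prod G C = ∞
  · simp [hCν, fun v => measure_mono_top (subset_union_left (t := translate v D)) hCν,
      tendsto_const_nhds]
  by_cases hDν : μ.prod G D = ∞
  · have hunion (v : V) : μ.prod G (C ∪ translate v D) = ∞ :=
      measure_mono_top subset_union_right ((measure_translate μ G hD v).trans hDν)
    simp [hDν, hunion, tendsto_const_nhds]
  have hunion (v : V) : μ.prod G (C ∪ translate v D) =
      μ.prod G C + μ.prod G D - μ.prod G (C ∩ translate v D) := by
    refine ENNReal.eq_sub_of_add_eq (measure_ne_top_of_subset inter_subset_left hCν) ?_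
    rw [measure_union_add_inter C (measurableSet_translate hD v), measure_translate μ G hD v]
  simpa only [hunion, tsub_zero] using ENNReal.Tendsto.sub tendsto_const_nhds
    (tendsto_measure_inter_translate μ G hC hD hCν hDν) (.inl (ENNReal.add_ne_top.2 ⟨hCν, hDν⟩))

end Translate

section Exceedance

variable {d : ℕ} {h : E d → ℝ≥0∞} {N : Set (E d × Weight)} {u : ℝ≥0∞} {G : Measure Weight}

/-- The marked points whose contribution to the shot noise at `y` exceeds the level `u`. -/
def exceedance (h : E d → ℝ≥0∞) (y : E d) (u : ℝ≥0∞) : Set (E d × Weight) :=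
  {q | u < ENNReal.ofReal (q.2 : ℝ) * h (y - q.1)}

theorem shotNoise_le_iff : shotNoise h N y ≤ u ↔ Disjoint N (exceedance h y u) := by
  simp only [shotNoise, iSup_le_iff, disjoint_left, exceedance, mem_ofPred_eq, not_lt]

theorem measurableSet_exceedance (hh : Measurable h) (y : E d) (u : ℝ≥0∞) :
    MeasurableSet (exceedance h y u) :=
  measurableSet_lt measurable_const (by fun_prop)

theorem exceedance_anti (h : E d → ℝ≥0∞) (y : E d) : Antitone (exceedance h y) :=
  fun _ _ huv _ hq => huv.trans_lt hq

theorem translate_exceedance (h : E d → ℝ≥0∞) (v y : E d) (u : ℝ≥0∞) :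
    translate v (exceedance h y u) = exceedance h (y + v) u := by
  ext q
  simp only [translate, exceedance, mem_ofPred_eq, sub_sub_eq_add_sub]

theorem prod_exceedance [SFinite G] (hh : Measurable h) (y : E d) (hu₀ : u ≠ 0) (hu : u ≠ ∞) :
    (volume : Measure (E d)).prod G (exceedance h y u) = ∫⁻ x, tail G (u / h x) := by
  rw [Measure.prod_apply (measurableSet_exceedance hh y u),
    ← lintegral_sub_left_eq_self (μ := volume) (fun x => tail G (u / h x)) y]
  refine lintegral_congr fun x => congrArg G ?_
  ext m
  exact (ENNReal.div_lt_iff (.inr hu₀) (.inr hu)).symm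

theorem prod_exceedance_of_lt_alpha [SFinite G] (hh : Measurable h) (y : E d) (hu₀ : 0 < u)
    (hu : u < alpha h G) : (volume : Measure (E d)).prod G (exceedance h y u) = ∞ := by
  rw [prod_exceedance hh y hu₀.ne' hu.ne_top]
  by_contra hne
  exact notMem_of_lt_csInf hu (OrderBot.bddBelow _) ⟨hu₀, hu.lt_top, lt_top_iff_ne_top.2 hne⟩

theorem prod_exceedance_of_alpha_lt [SFinite G] (hh : Measurable h) (y : E d)
    (hu : alpha h G < u) : (volume : Measure (E d)).prod G (exceedance h y u) ≠ ∞ := by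
  obtain ⟨v, ⟨hv₀, hv, hint⟩, hvu⟩ := sInf_lt_iff.1 hu
  refine measure_ne_top_of_subset (exceedance_anti h y hvu.le) ?_
  rw [prod_exceedance hh y hv₀.ne' hv.ne]
  exact hint.ne

/-- The marked points that make the shot noise exceed the level `t y` at some site `y ∈ F`. -/
def jointExceedance (h : E d → ℝ≥0∞) (F : Finset (E d)) (t : E d → ℝ≥0∞) : Set (E d × Weight) :=
  ⋃ y ∈ F, exceedance h y (t y)

theorem measurableSet_jointExceedance (hh : Measurable h) (F : Finset (E d)) (t : E d → ℝ≥0∞) :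
    MeasurableSet (jointExceedance h F t) :=
  F.measurableSet_biUnion fun y _ => measurableSet_exceedance hh y (t y)

theorem shift_shotNoise_mem_pi_Iic_iff {F : Finset (E d)} {t : E d → ℝ≥0∞} (v : E d) :
    shift v (shotNoise h N) ∈ (F : Set (E d)).pi (fun y => Iic (t y)) ↔
      count N (translate v (jointExceedance h F t)) = 0 := by
  have htranslate : translate v (jointExceedance h F t) = ⋃ y ∈ F, exceedance h (y + v) (t y) := by
    simp only [← translate_exceedance]
    ext; simp [translate, jointExceedance]
  simp only [count_eq_zero_iff, htranslate, disjoint_iUnion_right, ← shotNoise_le_iff]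
  rfl

theorem shotNoise_mem_pi_Iic_iff {F : Finset (E d)} {t : E d → ℝ≥0∞} :
    shotNoise h N ∈ (F : Set (E d)).pi (fun y => Iic (t y)) ↔
      count N (jointExceedance h F t) = 0 := by
  simpa [shift, translate] using shift_shotNoise_mem_pi_Iic_iff (h := h) (N := N) (F := F) 0

end Exceedance

section ShotNoiseMixing

variable {d : ℕ} {Ω : Type*} [MeasurableSpace Ω] {P : Measure Ω} {G : Measure Weight}
  {h : E d → ℝ≥0∞} {Φ : Ω → Set (E d × Weight)}

theorem measurable_shotNoise {ν : Measure (E d × Weight)} (hh : Measurable h)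
    (hΦ : IsPoissonPointProcess Φ ν P) : Measurable fun ω => shotNoise h (Φ ω) := by
  refine measurable_pi_lambda _ fun y => measurable_of_Iic fun u => ?_
  simp only [preimage, mem_Iic, shotNoise_le_iff, ← count_eq_zero_iff]
  exact hΦ.measurable_count _ (measurableSet_exceedance hh y u) (measurableSet_singleton 0)

variable [IsProbabilityMeasure P] [SFinite G]

theorem isStationary_shotNoise (hh : Measurable h)
    (hΦ : IsPoissonPointProcess Φ ((volume : Measure (E d)).prod G) P) :
    IsStationary shift (fun ω => shotNoise h (Φ ω)) P := by
  have hM := measurable_shotNoise hh hΦ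
  have hMv (v : E d) : Measurable fun ω => shift v (shotNoise h (Φ ω)) :=
    (measurable_shift v).comp hM
  refine ⟨hM, hMv, fun v => ?_⟩
  have := Measure.isProbabilityMeasure_map (μ := P) (hMv v).aemeasurable
  have := Measure.isProbabilityMeasure_map (μ := P) hM.aemeasurable
  refine ext_of_generate_finite _ (generateFrom_squareCylinders_Iic (E d) ℝ≥0∞).symm
    (isPiSystem_squareCylinders_Iic _ _) (forall_mem_squareCylinders_range.2 fun F t => ?_)
    (by simp)
  have hbox : MeasurableSet ((F : Set (E d)).pi fun y => Iic (t y)) :=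
    .pi F.countable_toSet fun _ _ => measurableSet_Iic
  have hD := measurableSet_jointExceedance hh F t
  rw [Measure.map_apply (hMv v) hbox, Measure.map_apply hM hbox]
  simp only [preimage, shift_shotNoise_mem_pi_Iic_iff, shotNoise_mem_pi_Iic_iff]
  rw [hΦ.measure_count_eq_zero (measurableSet_translate hD v), hΦ.measure_count_eq_zero hD,
    measure_translate volume G hD v]

theorem isAlphaMixing_shotNoise (hh : Measurable h)
    (hΦ : IsPoissonPointProcess Φ ((volume : Measure (E d)).prod G) P) :
    IsAlphaMixing shift (fun ω => shotNoise h (Φ ω)) P := by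
  refine (isStationary_shotNoise hh hΦ).isAlphaMixing_of_isPiSystem
    (generateFrom_squareCylinders_Iic _ _) (isPiSystem_squareCylinders_Iic _ _) ?_
  simp only [forall_mem_squareCylinders_range]
  intro F t F' t'
  have hC := measurableSet_jointExceedance hh F t
  have hD := measurableSet_jointExceedance hh F' t'
  have hjoint (v : E d) (ω : Ω) :
      count (Φ ω) (jointExceedance h F t) = 0 ∧
        count (Φ ω) (translate v (jointExceedance h F' t')) = 0 ↔
      count (Φ ω) (jointExceedance h F t ∪ translate v (jointExceedance h F' t')) = 0 := by
    simp only [count_eq_zero_iff, disjoint_union_right]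
  simp only [shift_shotNoise_mem_pi_Iic_iff, shotNoise_mem_pi_Iic_iff, hjoint,
    hΦ.measure_count_eq_zero hC, hΦ.measure_count_eq_zero hD,
    fun v => hΦ.measure_count_eq_zero (hC.union (measurableSet_translate hD v))]
  rw [← EReal.exp_add, ← sub_eq_add_neg, ← EReal.neg_add (.inl (EReal.coe_ennreal_ne_bot _))
    (.inr (EReal.coe_ennreal_ne_bot _)), ← EReal.coe_ennreal_add]
  exact ((ENNReal.continuous_exp.comp
    (continuous_neg.comp continuous_coe_ennreal_ereal)).tendsto _).comp
    (tendsto_measure_union_translate volume G hC hD)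

end ShotNoiseMixing

section Paths

theorem continuous_biSup_of_locally_finite_above {X ι α : Type*} [TopologicalSpace X]
    [CompleteLinearOrder α] [DenselyOrdered α] [TopologicalSpace α] [OrderTopology α]
    {s : Set ι} {f : ι → X → α} (hf : ∀ i ∈ s, Continuous (f i))
    (hfin : ∀ x, ∀ c > ⨆ i ∈ s, f i x, ∃ U ∈ 𝓝 x, {i ∈ s | ∃ x' ∈ U, c < f i x'}.Finite) :
    Continuous fun x => ⨆ i ∈ s, f i x := by
  refine continuous_iff_lower_upperSemicontinuous.2
    ⟨lowerSemicontinuous_biSup fun i hi => (hf i hi).lowerSemicontinuous, fun x c hc => ?_⟩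
  obtain ⟨b, hxb, hbc⟩ := exists_between hc
  obtain ⟨U, hU, hUfin⟩ := hfin x b hxb
  have hlarge : ∀ᶠ x' in 𝓝 x, ∀ i ∈ {i ∈ s | ∃ x' ∈ U, b < f i x'}, f i x' < b :=
    (eventually_all_finite hUfin).2 fun i hi =>
      ((hf i hi.1).tendsto x).eventually_lt_const ((le_biSup (f · x) hi.1).trans_lt hxb)
  filter_upwards [hlarge, hU] with x' hx' hx'U
  refine (iSup₂_le fun i hi => ?_).trans_lt hbc
  by_contra! hib
  exact hib.not_gt (hx' i ⟨hi, x', hx'U, hib⟩)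

variable {d : ℕ} {h : E d → ℝ≥0∞}

theorem measurable_hPlus (hh : Continuous h) : Measurable (hPlus h) :=
  (lowerSemicontinuous_biSup fun z _ =>
    (hh.comp (continuous_add_const z)).lowerSemicontinuous).measurable

theorem measurable_hMinus (hh : Continuous h) (ε : ℝ) : Measurable (hMinus h ε) :=
  (upperSemicontinuous_biInf fun z _ =>
    (hh.comp (continuous_add_const z)).upperSemicontinuous).measurable

theorem le_hPlus (h : E d → ℝ≥0∞) {x y : E d} (hxy : ‖y - x‖ ≤ 1) : h y ≤ hPlus h x := by
  have hle := le_biSup (fun z => h (x + z)) (show y - x ∈ {z : E d | ‖z‖ ≤ 1} from hxy)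
  rwa [add_sub_cancel] at hle

theorem hMinus_le (h : E d → ℝ≥0∞) {ε : ℝ} {x y : E d} (hxy : ‖y - x‖ ≤ ε) :
    hMinus h ε x ≤ h y := by
  have hle := biInf_le (fun z => h (x + z)) (show y - x ∈ {z : E d | ‖z‖ ≤ ε} from hxy)
  rwa [add_sub_cancel] at hle

theorem alpha_hMinus_anti (h : E d → ℝ≥0∞) (G : Measure Weight) :
    Antitone fun ε : ℝ => alpha (hMinus h ε) G := fun ε _ hε =>
  alpha_mono (fun _ => biInf_mono fun z (hz : ‖z‖ ≤ ε) => hz.trans hε) G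

theorem shotNoise_hMinus_le (h : E d → ℝ≥0∞) (N : Set (E d × Weight)) {ε : ℝ} {x y : E d}
    (hxy : ‖y - x‖ ≤ ε) : shotNoise (hMinus h ε) N x ≤ shotNoise h N y :=
  iSup₂_mono fun q _ => mul_le_mul_right (hMinus_le h (by rwa [sub_sub_sub_cancel_right])) _

theorem exceedance_subset_exceedance_hPlus (h : E d → ℝ≥0∞) (u : ℝ≥0∞) {x y : E d}
    (hxy : ‖y - x‖ ≤ 1) : exceedance h y u ⊆ exceedance (hPlus h) x u := fun q hq =>
  lt_of_lt_of_le hq <| mul_le_mul_right (le_hPlus h (by rwa [sub_sub_sub_cancel_right])) _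

variable {Ω : Type*} [MeasurableSpace Ω] {P : Measure Ω} {G : Measure Weight} [SFinite G]
  {Φ : Ω → Set (E d × Weight)}

theorem ae_alpha_le_shotNoise (hh : Measurable h)
    (hΦ : IsPoissonPointProcess Φ ((volume : Measure (E d)).prod G) P) (y : E d) :
    ∀ᵐ ω ∂P, alpha h G ≤ shotNoise h (Φ ω) y := by
  obtain hα | hα := eq_zero_or_pos (a := alpha h G)
  · simp [hα]
  obtain ⟨u, -, hu, hlim⟩ := exists_seq_strictMono_tendsto' hα
  have hlevel (n : ℕ) : ∀ᵐ ω ∂P, u n < shotNoise h (Φ ω) y := by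
    filter_upwards [hΦ.count_eq_top _ (measurableSet_exceedance hh y (u n))
      (prod_exceedance_of_lt_alpha hh y (hu n).1 (hu n).2)] with ω hω
    rw [← not_le, shotNoise_le_iff, ← count_eq_zero_iff, hω]
    exact ENat.top_ne_zero
  filter_upwards [ae_all_iff.2 hlevel] with ω hω
  exact le_of_tendsto' hlim fun n => (hω n).le

theorem ae_finite_inter_exceedance (hh : Measurable h)
    (hΦ : IsPoissonPointProcess Φ ((volume : Measure (E d)).prod G) P) (y : E d) :
    ∀ᵐ ω ∂P, ∀ u > alpha h G, (Φ ω ∩ exceedance h y u).Finite := by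
  obtain hα | hα := eq_top_or_lt_top (alpha h G)
  · simp [hα]
  obtain ⟨u, -, hu, hlim⟩ := exists_seq_strictAnti_tendsto' hα
  have hlevel (n : ℕ) : ∀ᵐ ω ∂P, (Φ ω ∩ exceedance h y (u n)).Finite :=
    hΦ.ae_finite_inter (measurableSet_exceedance hh y (u n))
      (prod_exceedance_of_alpha_lt hh y (hu n).1)
  filter_upwards [ae_all_iff.2 hlevel] with ω hω v hv
  obtain ⟨n, hn⟩ := (hlim.eventually_lt_const hv).exists
  exact (hω n).subset (inter_subset_inter_right _ (exceedance_anti h y hn.le))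

theorem ae_alphaMinus_le_shotNoise (hh : Continuous h)
    (hΦ : IsPoissonPointProcess Φ ((volume : Measure (E d)).prod G) P) :
    ∀ᵐ ω ∂P, ∀ y, alphaMinus h G ≤ shotNoise h (Φ ω) y := by
  have hae : ∀ᵐ ω ∂P, ∀ n k : ℕ, alpha (hMinus h (1 / (n + 1))) G ≤
      shotNoise (hMinus h (1 / (n + 1))) (Φ ω) (TopologicalSpace.denseSeq (E d) k) := by
    simp only [ae_all_iff]
    exact fun n k => ae_alpha_le_shotNoise (measurable_hMinus hh _) hΦ _
  filter_upwards [hae] with ω hω y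
  refine iSup₂_le fun ε hε => ?_
  obtain ⟨n, hn⟩ := exists_nat_one_div_lt (show (0 : ℝ) < ε from hε)
  obtain ⟨k, hk⟩ := (TopologicalSpace.denseRange_denseSeq (E d)).exists_dist_lt y
    (Nat.one_div_pos_of_nat (n := n))
  calc alpha (hMinus h ε) G ≤ alpha (hMinus h (1 / (n + 1))) G := alpha_hMinus_anti h G hn.le
    _ ≤ shotNoise (hMinus h (1 / (n + 1))) (Φ ω) (TopologicalSpace.denseSeq (E d) k) := hω n k
    _ ≤ shotNoise h (Φ ω) y := shotNoise_hMinus_le h _ (dist_eq_norm y _ ▸ hk.le)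

theorem ae_locally_finite_above_alphaPlus (hh : Continuous h)
    (hΦ : IsPoissonPointProcess Φ ((volume : Measure (E d)).prod G) P) :
    ∀ᵐ ω ∂P, ∀ u > alphaPlus h G, ∀ y, ∃ U ∈ 𝓝 y,
      {q ∈ Φ ω | ∃ y' ∈ U, q ∈ exceedance h y' u}.Finite := by
  have hae : ∀ᵐ ω ∂P, ∀ k : ℕ, ∀ u > alphaPlus h G,
      (Φ ω ∩ exceedance (hPlus h) (TopologicalSpace.denseSeq (E d) k) u).Finite :=
    ae_all_iff.2 fun k => ae_finite_inter_exceedance (measurable_hPlus hh) hΦ _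
  filter_upwards [hae] with ω hω u hu y
  obtain ⟨k, hk⟩ := (TopologicalSpace.denseRange_denseSeq (E d)).exists_dist_lt y one_pos
  refine ⟨Metric.ball (TopologicalSpace.denseSeq (E d) k) 1, Metric.isOpen_ball.mem_nhds hk,
    (hω k u hu).subset ?_⟩
  rintro q ⟨hq, y', hy', hqy'⟩
  exact ⟨hq, exceedance_subset_exceedance_hPlus h u (mem_ball_iff_norm.1 hy').le hqy'⟩

theorem ae_continuous_shotNoise (hh : Continuous h) (hα : alphaPlus h G ≤ alphaMinus h G)
    (hΦ : IsPoissonPointProcess Φ ((volume : Measure (E d)).prod G) P) :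
    ∀ᵐ ω ∂P, Continuous (shotNoise h (Φ ω)) := by
  filter_upwards [ae_alphaMinus_le_shotNoise hh hΦ, ae_locally_finite_above_alphaPlus hh hΦ]
    with ω hlow hfin
  exact continuous_biSup_of_locally_finite_above
    (fun q _ => (ENNReal.continuous_const_mul ENNReal.ofReal_ne_top).comp
      (hh.comp (continuous_sub_right q.1)))
    fun y u hu => hfin u ((hα.trans (hlow y)).trans_lt hu) y

end Paths

theorem sigmaFinite_of_tail_lt_top {G : Measure Weight}
    (hG : ∀ u : ℝ, 0 < u → tail G (ENNReal.ofReal u) < ∞) : SigmaFinite G := by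
  refine ⟨⟨⟨fun n : ℕ => {m | ENNReal.ofReal (1 / (n + 1)) < ENNReal.ofReal (m : ℝ)},
    fun _ => trivial, fun n => hG _ Nat.one_div_pos_of_nat, ?_⟩⟩⟩
  refine eq_univ_of_forall fun m => mem_iUnion.2 ?_
  obtain ⟨n, hn⟩ := exists_nat_one_div_lt (show (0 : ℝ) < m from m.2)
  exact ⟨n, (ENNReal.ofReal_lt_ofReal_iff m.2).2 hn⟩

end ShotNoise

theorem proposition2p8_general {d : ℕ} (hd : 1 ≤ d)
    {Ω : Type*} [MeasurableSpace Ω] (P : Measure Ω) [IsProbabilityMeasure P]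
    (G : Measure ShotNoise.Weight) [SFinite G]
    (h : ShotNoise.E d → ℝ≥0∞) (hh : Measurable h)
    (Φ : Ω → Set (ShotNoise.E d × ShotNoise.Weight))
    (hΦ : ShotNoise.IsPoissonPointProcess Φ ((volume : Measure (ShotNoise.E d)).prod G) P)
    (M : Ω → ShotNoise.E d → ℝ≥0∞) (hM : ∀ ω, M ω = ShotNoise.shotNoise h (Φ ω)) :
    (ShotNoise.IsAlphaMixing ShotNoise.shift M P ∧
      ShotNoise.IsErgodic ShotNoise.shift M P) ∧
    (Continuous h → ShotNoise.alphaMinus h G = ShotNoise.alphaPlus h G →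
      (∀ᵐ ω ∂P, Continuous (M ω)) ∧
      ∃ M' : Ω → C(ShotNoise.E d, ℝ≥0∞),
        (∀ᵐ ω ∂P, ⇑(M' ω) = M ω) ∧
        ShotNoise.IsAlphaMixing ShotNoise.shiftC M' P ∧
        ShotNoise.IsErgodic ShotNoise.shiftC M' P) := by
  obtain rfl : M = fun ω => ShotNoise.shotNoise h (Φ ω) := funext hM
  have hmix := ShotNoise.isAlphaMixing_shotNoise hh hΦ
  refine ⟨⟨hmix, hmix.isErgodic hd⟩, fun hc hα => ?_⟩
  have hcont := ShotNoise.ae_continuous_shotNoise hc hα.ge hΦ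
  obtain ⟨M', hM', hmix'⟩ := hmix.exists_continuousMap hcont
  exact ⟨hcont, M', hM', hmix', hmix'.isErgodic hd⟩

theorem proposition2p8 {d : ℕ} (hd : 1 ≤ d)
    {Ω : Type*} [MeasurableSpace Ω] (P : Measure Ω) [IsProbabilityMeasure P]
    (G : Measure ShotNoise.Weight)
    (hG : ∀ u : ℝ, 0 < u → ShotNoise.tail G (ENNReal.ofReal u) < ∞)
    (h : ShotNoise.E d → ℝ≥0∞) (hh : Measurable h)
    (Φ : Ω → Set (ShotNoise.E d × ShotNoise.Weight))
    (hΦ : ShotNoise.IsPoissonPointProcess Φ ((volume : Measure (ShotNoise.E d)).prod G) P)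
    (M : Ω → ShotNoise.E d → ℝ≥0∞) (hM : ∀ ω, M ω = ShotNoise.shotNoise h (Φ ω)) :
    (ShotNoise.IsAlphaMixing ShotNoise.shift M P ∧
      ShotNoise.IsErgodic ShotNoise.shift M P) ∧
    (Continuous h → ShotNoise.alphaMinus h G = ShotNoise.alphaPlus h G →
      (∀ᵐ ω ∂P, Continuous (M ω)) ∧
      ∃ M' : Ω → C(ShotNoise.E d, ℝ≥0∞),
        (∀ᵐ ω ∂P, ⇑(M' ω) = M ω) ∧
        ShotNoise.IsAlphaMixing ShotNoise.shiftC M' P ∧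
        ShotNoise.IsErgodic ShotNoise.shiftC M' P) := by
  have := ShotNoise.sigmaFinite_of_tail_lt_top hG
  exact proposition2p8_general hd P G h hh Φ hΦ M hM
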